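/- Let $G=(V,E)$ be an infinite, connected, locally finite (simple, undirected) graph whose simple cycles have uniformly bounded length, i.e. there is $\ell\in\mathbb N$ such that every simple cycle of $G$ has length at most $\ell$, and let $c:E\to(0,\infty)$ be any positive conductances. An exhaustion of $G$ is a sequence $V_1\subseteq V_2\subseteq\cdots$ of finite subsets of $V$ with $\bigcup_n V_n=V$ such that each induced subgraph $G_n=G[V_n]$ is connected; for such a $G_n$ let $\mathsf{UST}_{G_n}$ be the probability measure on the spanning trees $T$ of $G_n$ that gives $T$ probability proportional to $\prod_{e\in T}c(e)$. The free uniform spanning forest measure $\mathsf{FSF}$ of $(G,c)$ is the probability measure on subsets $\mathfrak F\subseteq E$ (with the product $\sigma$-algebra) such that $$\mathsf{FSF}(S\subseteq\mathfrak F)=\lim_{n\to\infty}\mathsf{UST}_{G_n}(S\subseteq T)$$ for every exhaustion $(V_n)$ and every finite set $S\subseteq E$. Then this measure exists and is unique, and $\mathsf{FSF}$-almost surely the graph $(V,\mathfrak F)$ consists of a single tree, i.e. it is connected and has no cycle. -/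

import Mathlib

open Filter Topology MeasureTheory

namespace FreeForest

open Classical in
/-- The edges of the subgraph of `G` induced by a finite vertex set `W`, i.e. the edges of `G`
with both endpoints in `W`. -/
noncomputable def inducedEdges {V : Type*} (G : SimpleGraph V) (W : Finset V) :
    Finset (Sym2 V) :=
  W.sym2.filter (fun e => e ∈ G.edgeSet)

open Classical in
/-- The spanning trees of the subgraph of `G` induced by `W`, each given by its edge set `T`:
the graph with vertex set `W` and edge set `T` is a tree. -/
noncomputable def spanningTrees {V : Type*} (G : SimpleGraph V) (W : Finset V) :
    Finset (Finset (Sym2 V)) :=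
  (inducedEdges G W).powerset.filter (fun T : Finset (Sym2 V) =>
    ((SimpleGraph.fromEdgeSet (T : Set (Sym2 V))).induce (W : Set V)).IsTree)

/-- The weight of a tree: the product of the conductances of its edges. -/
noncomputable def treeWeight {V : Type*} (c : Sym2 V → ℝ) (T : Finset (Sym2 V)) : ℝ :=
  ∏ e ∈ T, c e

open Classical in
/-- The probability that the uniform spanning tree of the finite network induced by `W` (a random
spanning tree whose law is proportional to `treeWeight c`) contains all the edges in `S`. -/
noncomputable def ustProb {V : Type*} (G : SimpleGraph V) (c : Sym2 V → ℝ) (W : Finset V)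
    (S : Set (Sym2 V)) : ℝ :=
  (∑ T ∈ (spanningTrees G W).filter (fun T : Finset (Sym2 V) => S ⊆ (T : Set (Sym2 V))), treeWeight c T) /
    ∑ T ∈ spanningTrees G W, treeWeight c T

/-- An exhaustion of `G`: an increasing sequence of finite connected vertex sets with union the
whole vertex set. -/
structure IsExhaustion {V : Type*} (G : SimpleGraph V) (W : ℕ → Finset V) : Prop where
  connected : ∀ n, (G.induce (W n : Set V)).Connected
  subset_succ : ∀ n, W n ⊆ W (n + 1)
  exhausts : ∀ v, ∃ n, v ∈ W n

/-- `μ` is the free uniform spanning forest measure of the network `(G, c)`: a probability measure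
on the subsets of the edge set (with the product σ-algebra) which is the weak limit of the uniform
spanning tree measures along every exhaustion, in the sense that the probabilities of the events
`S ⊆ 𝔉`, `S` a finite set of edges, converge. -/
structure IsFSF {V : Type*} (G : SimpleGraph V) (c : Sym2 V → ℝ)
    (μ : Measure (Set G.edgeSet)) : Prop where
  isProbabilityMeasure : IsProbabilityMeasure μ
  tendsto_ustProb : ∀ W : ℕ → Finset V, IsExhaustion G W → ∀ S : Finset G.edgeSet,
    Tendsto (fun n => ustProb G c (W n) (Subtype.val '' (S : Set G.edgeSet))) atTop
      (𝓝 (μ.real {ω : Set G.edgeSet | (S : Set G.edgeSet) ⊆ ω}))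

/-- The spanning subgraph of `G` with edge set `ω`. -/
def forestGraph {V : Type*} (G : SimpleGraph V) (ω : Set G.edgeSet) : SimpleGraph V :=
  SimpleGraph.fromEdgeSet (Subtype.val '' ω)

end FreeForest

/-! Call two edges equivalent if they are equal or lie on a common simple cycle; the classes are the
blocks of $G$. With cycle lengths bounded, the block of each edge is finite, since any path joining
the endpoints of an edge is that edge or closes up with it to a simple cycle
(`finite_setOf_pathMate`).

Every simple cycle lies in one block, so both acyclicity and joining the endpoints of edges can be
checked block by block. Choosing a maximal spanning forest of a finite edge set therefore amounts to
independent choices on each block it contains and on the remaining edges, and the weight is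
multiplicative (`forestSum_eq_mul`, `forestProb_eq_prod`). Once $G_n$ contains the blocks meeting
$S$, the probability that the tree contains $S$ is a product over those blocks and no longer depends
on $n$. The limit is thus attained by independent random spanning trees of the blocks
(`blockForestMeasure`), and inclusion probabilities determine the measure.

Such a configuration almost surely spans every block by a tree. It is connected because the
endpoints of each edge of $G$ are joined within its block, and acyclic because a cycle would lie in
one block (`isTree_forestGraph`). -/

namespace FreeForest

open SimpleGraph

variable {V : Type*} {G : SimpleGraph V}

/-! ### Blocks: the same-block relation on edges -/

/-- `f` lies on a path of `G` joining the two endpoints of `e`. For edges `e` and `f` of `G` this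
says that they are in the same block. -/
def PathMate (G : SimpleGraph V) (e f : Sym2 V) : Prop :=
  ∃ (a b : V) (p : G.Walk a b), p.IsPath ∧ s(a, b) = e ∧ f ∈ p.edges

theorem exists_append_cons_of_mem_edges {u v : V} (p : G.Walk u v) {e : Sym2 V}
    (he : e ∈ p.edges) :
    ∃ (x y : V) (h : G.Adj x y) (q : G.Walk u x) (r : G.Walk y v),
      p = q.append (Walk.cons h r) ∧ e = s(x, y) := by
  induction p with
  | nil => simp at he
  | @cons u w v h p ih =>
    rw [Walk.edges_cons, List.mem_cons] at he
    rcases he with rfl | he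
    · exact ⟨u, w, h, Walk.nil, p, rfl, rfl⟩
    · obtain ⟨x, y, h', q, r, rfl, rfl⟩ := ih he
      exact ⟨x, y, h', Walk.cons h q, r, rfl, rfl⟩

theorem PathMate.exists_path {a b : V} {f : Sym2 V} (h : PathMate G s(a, b) f) :
    ∃ p : G.Walk a b, p.IsPath ∧ f ∈ p.edges := by
  obtain ⟨a', b', p, hp, he, hf⟩ := h
  rcases Sym2.eq_iff.1 he with ⟨rfl, rfl⟩ | ⟨rfl, rfl⟩
  · exact ⟨p, hp, hf⟩
  · exact ⟨p.reverse, hp.reverse, by simpa using hf⟩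

theorem PathMate.refl {e : Sym2 V} (he : e ∈ G.edgeSet) : PathMate G e e := by
  induction e with
  | h a b =>
    have hab : G.Adj a b := he
    exact ⟨a, b, hab.toWalk, hab.isPath_toWalk, rfl, by simp⟩

/-- Path and edge `e` form a cycle: deleting `f` from the path and inserting `e` instead joins the
endpoints of `f`. -/
theorem PathMate.symm {e f : Sym2 V} (he : e ∈ G.edgeSet) (h : PathMate G e f) :
    PathMate G f e := by
  obtain ⟨a, b, p, hp, rfl, hf⟩ := h
  obtain ⟨x, y, h, q, r, rfl, rfl⟩ := exists_append_cons_of_mem_edges p hf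
  have hab : G.Adj a b := he
  refine ⟨x, y, q.reverse.append (Walk.cons hab r.reverse), ?_, rfl, by simp⟩
  rw [Walk.isPath_def] at hp ⊢
  simp only [Walk.support_append, Walk.support_cons, List.tail_cons, Walk.support_reverse,
    List.nodup_append', List.nodup_reverse] at hp ⊢
  exact ⟨hp.1, hp.2.1, by simpa using hp.2.2⟩

theorem PathMate.mem_edgeSet {e f : Sym2 V} (h : PathMate G e f) : f ∈ G.edgeSet := by
  obtain ⟨a, b, p, -, -, hf⟩ := h
  exact p.edges_subset_edgeSet hf

theorem exists_path_of_append {a u w b : V} (p₁ : G.Walk a u) (p₂ : G.Walk u w) (p₃ : G.Walk w b)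
    (hp : (p₁.append (p₂.append p₃)).IsPath) (q : G.Walk u w) (hq : q.IsPath) (huw : u ≠ w)
    (hqp : ∀ z ∈ q.support, z ∈ (p₁.append (p₂.append p₃)).support → z = u ∨ z = w) :
    (p₁.append (q.append p₃)).IsPath := by
  -- This places `w` strictly after `p₁` and before the tail of `p₃`, so the new segment cannot
  -- revisit it.
  have hw : w ∈ p₂.support.tail := Walk.end_mem_tail_support_of_ne huw p₂
  rw [Walk.isPath_def] at *
  rw [Walk.support_append, Walk.tail_support_append] at *
  simp only [List.nodup_append', List.mem_append] at hp hqp ⊢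
  have hq' := hq
  rw [← Walk.cons_tail_support, List.nodup_cons] at hq'
  have h3 : w ∉ p₃.support.tail := fun h => hp.2.1.2.2 hw h
  have h1 : w ∉ p₁.support := fun h => hp.2.2 h (by simp [hw])
  refine ⟨hp.1, ⟨hq'.2, hp.2.1.2.1, ?_⟩, ?_⟩
  · intro z hz hz3
    rcases hqp z (List.mem_of_mem_tail hz) (by tauto) with rfl | rfl
    · exact hq'.1 hz
    · exact h3 hz3
  · intro z hz1 hz
    rcases List.mem_append.1 hz with hz | hz
    · rcases hqp z (List.mem_of_mem_tail hz) (by tauto) with rfl | rfl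
      · exact hq'.1 hz
      · exact h1 hz1
    · exact hp.2.2 hz1 (by simp [hz])

/-- A path can be rerouted through an ear `q` attached to it. -/
theorem exists_path_through_ear {a b u w : V} {p : G.Walk a b} (hp : p.IsPath) {q : G.Walk u w}
    (hq : q.IsPath) (huw : u ≠ w) (hu : u ∈ p.support) (hw : w ∈ p.support)
    (hqp : ∀ z ∈ q.support, z ∈ p.support → z = u ∨ z = w) {g : Sym2 V} (hg : g ∈ q.edges) :
    ∃ p' : G.Walk a b, p'.IsPath ∧ g ∈ p'.edges := by
  obtain ⟨p₁, p₂, rfl⟩ := Walk.mem_support_iff_exists_append.1 hu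
  rcases (Walk.mem_support_append_iff _ _).1 hw with hw | hw
  · obtain ⟨p₀, p₁, rfl⟩ := Walk.mem_support_iff_exists_append.1 hw
    rw [← Walk.append_assoc] at hp hqp
    exact ⟨_, exists_path_of_append _ _ _ hp q.reverse hq.reverse huw.symm
      (fun z hz hz' => (hqp z (by simpa using hz) hz').symm), by simp [hg]⟩
  · obtain ⟨p₂, p₃, rfl⟩ := Walk.mem_support_iff_exists_append.1 hw
    exact ⟨_, exists_path_of_append _ _ _ hp q hq huw hqp, by simp [hg]⟩

/-- Every edge of a path with both endpoints in `S` is on a subpath whose endpoints are in `S`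
and whose interior vertices are not. -/
theorem exists_ear (S : Set V) {g : Sym2 V} (n : ℕ) {x y : V} (r : G.Walk x y) (hn : r.length ≤ n)
    (hr : r.IsPath) (hx : x ∈ S) (hy : y ∈ S) (hg : g ∈ r.edges) :
    ∃ (u w : V) (q : G.Walk u w), q.IsPath ∧ u ≠ w ∧ u ∈ S ∧ w ∈ S ∧ g ∈ q.edges ∧
      ∀ z ∈ q.support, z ∈ S → z = u ∨ z = w := by
  induction n generalizing x y with
  | zero =>
    obtain rfl := Walk.eq_of_length_eq_zero (Nat.le_zero.1 hn)
    simp [Walk.edges_eq_nil.2 (Walk.isPath_iff_nil.1 hr)] at hg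
  | succ n ih =>
    by_cases hint : ∀ z ∈ r.support, z ∈ S → z = x ∨ z = y
    · refine ⟨x, y, r, hr, ?_, hx, hy, hg, hint⟩
      rintro rfl
      simp [Walk.edges_eq_nil.2 (Walk.isPath_iff_nil.1 hr)] at hg
    · push Not at hint
      obtain ⟨z, hz, hzS, hzx, hzy⟩ := hint
      -- Cutting at an interior vertex of `S` gives two strictly shorter paths with ends in `S`, one
      -- of which carries `g`.
      obtain ⟨r₁, r₂, rfl⟩ := Walk.mem_support_iff_exists_append.1 hz
      rw [Walk.length_append] at hn
      have h₁ : r₁.length ≠ 0 := fun h => hzx (Walk.eq_of_length_eq_zero h).symm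
      have h₂ : r₂.length ≠ 0 := fun h => hzy (Walk.eq_of_length_eq_zero h)
      rw [Walk.edges_append, List.mem_append] at hg
      rcases hg with hg | hg
      · exact ih r₁ (by omega) hr.of_append_left hx hzS hg
      · exact ih r₂ (by omega) hr.of_append_right hzS hy hg

/-- The path through `g` starts and ends on `p`, at the endpoints of `f`. Its piece around `g`
between consecutive visits to `p` is an ear, through which `p` can be rerouted. -/
theorem PathMate.trans {e f g : Sym2 V} (hef : PathMate G e f) (hfg : PathMate G f g) :
    PathMate G e g := by
  obtain ⟨a, b, p, hp, rfl, hf⟩ := hef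
  obtain ⟨x, y, r, hr, rfl, hg⟩ := hfg
  obtain ⟨u, w, q, hq, huw, hu, hw, hgq, hqp⟩ := exists_ear {z | z ∈ p.support} r.length r le_rfl hr
    (p.fst_mem_support_of_mem_edges hf) (p.snd_mem_support_of_mem_edges hf) hg
  obtain ⟨p', hp', hg'⟩ := exists_path_through_ear hp hq huw hu hw hqp hgq
  exact ⟨a, b, p', hp', rfl, hg'⟩

theorem PathMate.of_isCycle {v : V} {C : G.Walk v v} (hC : C.IsCycle) {f g : Sym2 V}
    (hf : f ∈ C.edges) (hg : g ∈ C.edges) : PathMate G f g := by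
  have hfG := C.edges_subset_edgeSet hf
  obtain ⟨x, y, h, q, r, rfl, rfl⟩ := exists_append_cons_of_mem_edges C hf
  rcases eq_or_ne g s(x, y) with rfl | hne
  · exact PathMate.refl hfG
  · refine ⟨y, x, r.append q, ?_, Sym2.eq_swap, ?_⟩
    · have := hC.support_nodup
      rw [Walk.tail_support_append, Walk.support_cons, List.tail_cons, List.nodup_append'] at this
      rw [Walk.isPath_def, Walk.support_append, List.nodup_append']
      exact ⟨this.2.1, this.1, this.2.2.symm⟩
    · simpa [hne, or_comm] using hg

/-! ### Cycle-closed edge sets -/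

/-- A set of edges is closed if every simple cycle is contained in it or disjoint from it. -/
def CycleClosed (G : SimpleGraph V) (K : Set (Sym2 V)) : Prop :=
  ∀ (v : V) (p : G.Walk v v), p.IsCycle → ∀ e ∈ p.edges, ∀ f ∈ p.edges, e ∈ K → f ∈ K

theorem CycleClosed.compl {K : Set (Sym2 V)} (hK : CycleClosed G K) : CycleClosed G Kᶜ :=
  fun v p hp e he f hf heK hfK => heK (hK v p hp f hf e he hfK)

theorem cycleClosed_setOf_pathMate (e : Sym2 V) : CycleClosed G {f | PathMate G e f} :=
  fun _ _ hp _ hf _ hg hef => PathMate.trans hef (.of_isCycle hp hf hg)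

/-! ### Balls: an exhaustion, and finiteness of blocks -/

open scoped Classical in
/-- The finite vertex sets obtained from `{v}` by repeatedly adding all neighbours. -/
noncomputable def finBall (G : SimpleGraph V) [G.LocallyFinite] (v : V) : ℕ → Finset V
  | 0 => {v}
  | n + 1 => finBall G v n ∪ (finBall G v n).biUnion fun w => G.neighborFinset w

section Ball

variable [G.LocallyFinite]

theorem finBall_subset_succ (v : V) (n : ℕ) : finBall G v n ⊆ finBall G v (n + 1) := by
  classical exact Finset.subset_union_left

theorem mem_finBall_self (v : V) (n : ℕ) : v ∈ finBall G v n := by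
  induction n with
  | zero => simp [finBall]
  | succ n ih => exact finBall_subset_succ v n ih

theorem mem_finBall_of_walk {v w : V} (p : G.Walk v w) (n : ℕ) (hn : p.length ≤ n) :
    w ∈ finBall G v n := by
  induction n generalizing w with
  | zero => simp [finBall, Walk.eq_of_length_eq_zero (Nat.le_zero.1 hn)]
  | succ n ih =>
    rcases Nat.lt_or_ge p.length (n + 1) with h | h
    · exact finBall_subset_succ v n (ih p (by omega))
    · have hp : ¬ p.Nil := by
        rw [← Walk.length_eq_zero_iff]; omega
      have := ih p.dropLast (by rw [Walk.length_dropLast]; omega)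
      classical
      rw [finBall, Finset.mem_union, Finset.mem_biUnion]
      exact Or.inr ⟨_, this, by simpa using p.adj_penultimate hp⟩

theorem connected_induce_finBall (v : V) (n : ℕ) :
    (G.induce (finBall G v n : Set V)).Connected := by
  rw [connected_iff_exists_forall_reachable]
  refine ⟨⟨v, mem_finBall_self v n⟩, ?_⟩
  induction n with
  | zero =>
    rintro ⟨w, hw⟩
    obtain rfl : w = v := by simpa [finBall] using hw
    exact .rfl
  | succ n ih =>
    have mono : ∀ (w : V) (hw : w ∈ finBall G v n),
        (G.induce (finBall G v (n + 1) : Set V)).Reachable ⟨v, mem_finBall_self v _⟩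
          ⟨w, finBall_subset_succ v n hw⟩ := fun w hw =>
      (ih ⟨w, hw⟩).map (G.induceHomOfLE (Finset.coe_subset.2 (finBall_subset_succ v n))).toHom
    rintro ⟨w, hw⟩
    have hw' := hw
    classical
    rw [Finset.mem_coe, finBall, Finset.mem_union, Finset.mem_biUnion] at hw'
    rcases hw' with hw' | ⟨z, hz, hzw⟩
    · exact mono w hw'
    · refine (mono z hz).trans (Adj.reachable ?_)
      simpa using hzw

theorem isExhaustion_finBall (hG : G.Connected) (v : V) : IsExhaustion G (finBall G v) where
  connected := connected_induce_finBall v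
  subset_succ := finBall_subset_succ v
  exhausts w := by
    obtain ⟨p⟩ := hG.preconnected v w
    exact ⟨p.length, mem_finBall_of_walk p _ le_rfl⟩

theorem finite_setOf_pathMate {ℓ : ℕ}
    (hℓ : ∀ (v : V) (p : G.Walk v v), p.IsCycle → p.length ≤ ℓ) {e : Sym2 V}
    (he : e ∈ G.edgeSet) : {f | PathMate G e f}.Finite := by
  induction e with
  | h a b =>
    refine ((finBall G a (ℓ + 1)).sym2.finite_toSet).subset fun f hf => ?_
    obtain ⟨p, hp, hf⟩ := PathMate.exists_path hf
    -- The extra 1 covers the path consisting of the edge alone, as `ℓ` may be 0 when there are no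
    -- cycles.
    have hlen : p.length ≤ ℓ + 1 := by
      by_cases hab : s(a, b) ∈ p.edges
      · rw [hp.length_eq_one_of_mem_edges hab]; omega
      · have := hℓ b _ (Path.cons_isCycle ⟨p, hp⟩ (G.adj_symm he) (by rwa [Sym2.eq_swap]))
        rw [Walk.length_cons] at this
        simp only at this
        omega
    rw [Finset.mem_coe, Finset.mem_sym2_iff]
    intro z hz
    obtain ⟨q, r, rfl⟩ := Walk.mem_support_iff_exists_append.1 (p.mem_support_of_mem_edges hf hz)
    rw [Walk.length_append] at hlen
    exact mem_finBall_of_walk q _ (by omega)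

end Ball

/-! ### Maximal spanning forests and their restriction to closed sets -/

open scoped Classical in
/-- The maximal spanning forests of the graph with finite edge set `E`, each given by its
edge set. -/
noncomputable def spanningForests (E : Finset (Sym2 V)) : Finset (Finset (Sym2 V)) :=
  E.powerset.filter fun T : Finset (Sym2 V) => (fromEdgeSet (T : Set (Sym2 V))).IsAcyclic ∧
    ∀ u v, s(u, v) ∈ E → (fromEdgeSet (T : Set (Sym2 V))).Reachable u v

theorem mem_spanningForests {E T : Finset (Sym2 V)} : T ∈ spanningForests E ↔
    T ⊆ E ∧ (fromEdgeSet (T : Set (Sym2 V))).IsAcyclic ∧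
      ∀ u v, s(u, v) ∈ E → (fromEdgeSet (T : Set (Sym2 V))).Reachable u v := by
  classical
  rw [spanningForests, Finset.mem_filter, Finset.mem_powerset]

theorem spanningForests_nonempty (E : Finset (Sym2 V)) : (spanningForests E).Nonempty := by
  classical
  obtain ⟨F, hFE, hF, hr⟩ := (fromEdgeSet (E : Set (Sym2 V))).exists_isAcyclic_reachable_eq_le
  have hcoe : ((E.filter (· ∈ F.edgeSet) : Finset (Sym2 V)) : Set (Sym2 V)) = F.edgeSet := by
    ext e
    have : e ∈ F.edgeSet → e ∈ E := fun he => by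
      have := edgeSet_mono hFE he
      rw [edgeSet_fromEdgeSet] at this
      exact this.1
    simpa using this
  refine ⟨E.filter (· ∈ F.edgeSet), mem_spanningForests.2 ⟨Finset.filter_subset _ _, ?_⟩⟩
  rw [hcoe, fromEdgeSet_edgeSet]
  refine ⟨hF, fun u v huv => ?_⟩
  rw [hr]
  rcases eq_or_ne u v with rfl | hne
  · exact .rfl
  · exact Adj.reachable (by simpa using ⟨huv, hne⟩)

/-- A path joining the endpoints of an edge of `G` uses edges of the same closed sets as that
edge. -/
theorem CycleClosed.reachable_inter {K T : Set (Sym2 V)} (hK : CycleClosed G K)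
    (hT : T ⊆ G.edgeSet) {u v : V} (huv : G.Adj u v) (hmem : s(u, v) ∈ K)
    (h : (fromEdgeSet T).Reachable u v) : (fromEdgeSet (T ∩ K)).Reachable u v := by
  by_cases huvT : s(u, v) ∈ T
  · exact Adj.reachable ((fromEdgeSet_adj _).2 ⟨⟨huvT, hmem⟩, huv.ne⟩)
  obtain ⟨p, hp⟩ := h.exists_isPath
  have hpT : ∀ e ∈ p.edges, e ∈ T := fun e he =>
    (edgeSet_fromEdgeSet T ▸ p.edges_subset_edgeSet he).1
  have hpG : ∀ e ∈ p.edges, e ∈ G.edgeSet := fun e he => hT (hpT e he)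
  -- The edge `uv` is not in `T`, so it closes the path to a simple cycle of `G`. This cycle meets
  -- `K`, hence lies in `K`.
  have hcyc := Path.cons_isCycle ⟨p.transfer G hpG, hp.transfer hpG⟩ huv.symm
    (by simpa [Sym2.eq_swap] using fun h => huvT (hpT _ h))
  refine ⟨p.transfer _ fun e he => ?_⟩
  rw [edgeSet_fromEdgeSet]
  refine ⟨⟨hpT e he, hK _ _ hcyc s(v, u) (by simp) e (by simp [he]) (by rwa [Sym2.eq_swap])⟩, ?_⟩
  exact G.not_isDiag_of_mem_edgeSet (hpG e he)

/-- Expresses acyclicity through cycles of the ambient `G`, to which `CycleClosed` applies. -/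
theorem isAcyclic_fromEdgeSet_iff {T : Set (Sym2 V)} (hT : T ⊆ G.edgeSet) :
    (fromEdgeSet T).IsAcyclic ↔
      ∀ (v : V) (p : G.Walk v v), p.IsCycle → ¬ ∀ e ∈ p.edges, e ∈ T := by
  constructor
  · intro h v p hp hpT
    refine h (p.transfer _ fun e he => ?_) (hp.transfer _)
    rw [edgeSet_fromEdgeSet]
    exact ⟨hpT e he, G.not_isDiag_of_mem_edgeSet (hT (hpT e he))⟩
  · intro h v p hp
    have hpT : ∀ e ∈ p.edges, e ∈ T := fun e he =>
      (edgeSet_fromEdgeSet T ▸ p.edges_subset_edgeSet he).1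
    exact h v (p.transfer G fun e he => hT (hpT e he)) (hp.transfer _) (by simpa using hpT)

theorem CycleClosed.isAcyclic_union {K A B : Set (Sym2 V)} (hK : CycleClosed G K)
    (hA : A ⊆ G.edgeSet) (hB : B ⊆ G.edgeSet) (hAK : A ⊆ K) (hBK : B ⊆ Kᶜ)
    (hA' : (fromEdgeSet A).IsAcyclic) (hB' : (fromEdgeSet B).IsAcyclic) :
    (fromEdgeSet (A ∪ B)).IsAcyclic := by
  rw [isAcyclic_fromEdgeSet_iff (Set.union_subset hA hB)]
  rw [isAcyclic_fromEdgeSet_iff hA] at hA'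
  rw [isAcyclic_fromEdgeSet_iff hB] at hB'
  intro v p hp hpT
  by_cases h : ∃ e ∈ p.edges, e ∈ K
  · obtain ⟨e, he, heK⟩ := h
    exact hA' v p hp fun f hf =>
      (hpT f hf).resolve_right fun hfB => hBK hfB (hK v p hp e he f hf heK)
  · push Not at h
    exact hB' v p hp fun f hf => (hpT f hf).resolve_left fun hfA => h f hf (hAK hfA)

/-- Stated for an arbitrary closed set `K'` so that it serves for a block union and for its infinite
complement alike. -/
theorem mem_spanningForests_of_cycleClosed {E : Finset (Sym2 V)}
    (hE : (E : Set (Sym2 V)) ⊆ G.edgeSet)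
    {K' : Set (Sym2 V)} (hK' : CycleClosed G K') {T D U : Finset (Sym2 V)}
    (hT : T ∈ spanningForests E) (hD : (D : Set (Sym2 V)) = (E : Set (Sym2 V)) ∩ K')
    (hU : (U : Set (Sym2 V)) = (T : Set (Sym2 V)) ∩ K') : U ∈ spanningForests D := by
  obtain ⟨hTE, hac, hr⟩ := mem_spanningForests.1 hT
  rw [← Finset.coe_subset] at hTE
  rw [mem_spanningForests, ← Finset.coe_subset, hU, hD]
  refine ⟨Set.inter_subset_inter_left _ hTE,
    hac.anti (fromEdgeSet_mono Set.inter_subset_left), fun u v huv => ?_⟩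
  have huv' : s(u, v) ∈ (E : Set (Sym2 V)) ∩ K' := hD ▸ huv
  exact hK'.reachable_inter (hTE.trans hE) (hE huv'.1) huv'.2 (hr u v huv'.1)

theorem union_mem_spanningForests [DecidableEq (Sym2 V)] {E K : Finset (Sym2 V)}
    (hE : (E : Set (Sym2 V)) ⊆ G.edgeSet) (hKE : K ⊆ E)
    (hK : CycleClosed G (K : Set (Sym2 V))) {A B : Finset (Sym2 V)}
    (hA : A ∈ spanningForests K) (hB : B ∈ spanningForests (E \ K)) :
    A ∪ B ∈ spanningForests E := by
  obtain ⟨hAK, hA, hrA⟩ := mem_spanningForests.1 hA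
  obtain ⟨hBK, hB, hrB⟩ := mem_spanningForests.1 hB
  rw [mem_spanningForests, Finset.coe_union]
  refine ⟨Finset.union_subset (hAK.trans hKE) (hBK.trans Finset.sdiff_subset), ?_, ?_⟩
  · refine hK.isAcyclic_union ?_ ?_ hAK ?_ hA hB
    · exact (Finset.coe_subset.2 (hAK.trans hKE)).trans hE
    · exact (Finset.coe_subset.2 (hBK.trans Finset.sdiff_subset)).trans hE
    · exact fun e he => by simpa using (Finset.mem_sdiff.1 (hBK he)).2
  · intro u v huv
    by_cases h : s(u, v) ∈ K
    · exact (hrA u v h).mono (fromEdgeSet_mono Set.subset_union_left)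
    · exact (hrB u v (Finset.mem_sdiff.2 ⟨huv, h⟩)).mono (fromEdgeSet_mono Set.subset_union_right)

/-! ### Factorization of forest weights and probabilities -/

open scoped Classical in
/-- The total weight of the maximal spanning forests of `E` that contain `S`. -/
noncomputable def forestSum (c : Sym2 V → ℝ) (E : Finset (Sym2 V)) (S : Set (Sym2 V)) : ℝ :=
  ∑ T ∈ (spanningForests E).filter (fun T : Finset (Sym2 V) => S ⊆ (T : Set (Sym2 V))),
    treeWeight c T

theorem forestSum_empty (c : Sym2 V → ℝ) (E : Finset (Sym2 V)) :
    forestSum c E ∅ = ∑ T ∈ spanningForests E, treeWeight c T := by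
  simp [forestSum]

theorem treeWeight_pos {c : Sym2 V → ℝ} {E T : Finset (Sym2 V)} (hc : ∀ e ∈ E, 0 < c e)
    (hT : T ∈ spanningForests E) : 0 < treeWeight c T :=
  Finset.prod_pos fun e he => hc e ((mem_spanningForests.1 hT).1 he)

theorem forestSum_empty_pos {c : Sym2 V → ℝ} {E : Finset (Sym2 V)} (hc : ∀ e ∈ E, 0 < c e) :
    0 < forestSum c E ∅ := by
  rw [forestSum_empty]
  exact Finset.sum_pos (fun T hT => treeWeight_pos hc hT) (spanningForests_nonempty E)

-- `T ↦ (T ∩ K, T \ K)` is a weight-preserving bijection onto pairs of forests, inverse to taking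
-- unions.
open scoped Classical in
theorem forestSum_eq_mul (c : Sym2 V → ℝ) {E K : Finset (Sym2 V)}
    (hE : (E : Set (Sym2 V)) ⊆ G.edgeSet) (hKE : K ⊆ E) (hK : CycleClosed G (K : Set (Sym2 V)))
    (S : Set (Sym2 V)) :
    forestSum c E S = forestSum c K (S ∩ K) * forestSum c (E \ K) (S \ K) := by
  have key : ∀ {A B : Finset (Sym2 V)}, A ⊆ K → B ⊆ E \ K →
      (A ∪ B) ∩ K = A ∧ (A ∪ B) \ K = B := by
    intro A B hA hB
    constructor <;> ext e <;> have := @hA e <;> have := @hB e <;>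
      simp only [Finset.mem_inter, Finset.mem_union, Finset.mem_sdiff] at * <;> tauto
  rw [forestSum, forestSum, forestSum, Finset.sum_mul_sum, ← Finset.sum_product']
  refine Finset.sum_bij' (fun T _ => (T ∩ K, T \ K)) (fun AB _ => AB.1 ∪ AB.2) ?_ ?_ ?_ ?_ ?_
  · intro T hT
    rw [Finset.mem_filter] at hT
    simp only [Finset.mem_product, Finset.mem_filter]
    refine ⟨⟨?_, ?_⟩, ?_, ?_⟩
    · refine mem_spanningForests_of_cycleClosed hE hK hT.1 ?_ (Finset.coe_inter _ _)
      exact (Set.inter_eq_right.2 (Finset.coe_subset.2 hKE)).symm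
    · rw [Finset.coe_inter]
      exact Set.inter_subset_inter_left _ hT.2
    · exact mem_spanningForests_of_cycleClosed hE hK.compl hT.1 (Finset.coe_sdiff _ _)
        (Finset.coe_sdiff _ _)
    · rw [Finset.coe_sdiff]
      exact Set.sdiff_subset_sdiff_left hT.2
  · rintro ⟨A, B⟩ hAB
    simp only [Finset.mem_product, Finset.mem_filter] at hAB
    rw [Finset.mem_filter, Finset.coe_union]
    refine ⟨union_mem_spanningForests hE hKE hK hAB.1.1 hAB.2.1, fun e he => ?_⟩
    by_cases h : e ∈ (K : Set (Sym2 V))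
    · exact Or.inl (hAB.1.2 ⟨he, h⟩)
    · exact Or.inr (hAB.2.2 ⟨he, h⟩)
  · intro T _
    ext e
    simp only [Finset.mem_union, Finset.mem_inter, Finset.mem_sdiff]
    tauto
  · rintro ⟨A, B⟩ hAB
    simp only [Finset.mem_product, Finset.mem_filter] at hAB
    have := key (mem_spanningForests.1 hAB.1.1).1 (mem_spanningForests.1 hAB.2.1).1
    exact Prod.ext this.1 this.2
  · intro T _
    exact (Finset.prod_inter_mul_prod_sdiff T K c).symm

/-- The probability that a random maximal spanning forest of `E`, with law proportional to
`treeWeight c`, contains `S`. -/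
noncomputable def forestProb (c : Sym2 V → ℝ) (E : Finset (Sym2 V)) (S : Set (Sym2 V)) : ℝ :=
  forestSum c E S / forestSum c E ∅

theorem forestProb_empty {c : Sym2 V → ℝ} {E : Finset (Sym2 V)} (hc : ∀ e ∈ E, 0 < c e) :
    forestProb c E ∅ = 1 :=
  div_self (forestSum_empty_pos hc).ne'

open scoped Classical in
theorem forestProb_eq_mul (c : Sym2 V → ℝ) {E K : Finset (Sym2 V)}
    (hE : (E : Set (Sym2 V)) ⊆ G.edgeSet) (hKE : K ⊆ E) (hK : CycleClosed G (K : Set (Sym2 V)))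
    (S : Set (Sym2 V)) :
    forestProb c E S = forestProb c K (S ∩ K) * forestProb c (E \ K) (S \ K) := by
  rw [forestProb, forestProb, forestProb, forestSum_eq_mul c hE hKE hK S,
    forestSum_eq_mul c hE hKE hK ∅, Set.empty_inter, Set.empty_sdiff, mul_div_mul_comm]

/-- The sets in `s` only need to cover `S`: what remains of `E` contributes the probability of
containing `∅`, which is 1. Hence the right side does not depend on `E`. -/
theorem forestProb_eq_prod {c : Sym2 V → ℝ} (hc : ∀ e ∈ G.edgeSet, 0 < c e)
    (s : Finset (Finset (Sym2 V))) {E : Finset (Sym2 V)} (hE : (E : Set (Sym2 V)) ⊆ G.edgeSet)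
    (hsE : ∀ K ∈ s, K ⊆ E) (hs : ∀ K ∈ s, CycleClosed G (K : Set (Sym2 V)))
    (hdisj : (s : Set (Finset (Sym2 V))).PairwiseDisjoint id) {S : Set (Sym2 V)}
    (hS : ∀ e ∈ S, ∃ K ∈ s, e ∈ K) :
    forestProb c E S = ∏ K ∈ s, forestProb c K (S ∩ K) := by
  classical
  induction s using Finset.induction_on generalizing E S with
  | empty =>
    obtain rfl : S = ∅ := Set.eq_empty_of_forall_notMem fun e he => by simpa using hS e he
    rw [Finset.prod_empty, forestProb_empty fun e he => hc e (hE he)]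
  | insert K s hKs ih =>
    have hne : ∀ L ∈ s, Disjoint L K := fun L hL =>
      hdisj (Finset.mem_insert_of_mem hL) (Finset.mem_insert_self K s) fun h => hKs (h ▸ hL)
    rw [forestProb_eq_mul c hE (hsE K (Finset.mem_insert_self K s))
      (hs K (Finset.mem_insert_self K s)), Finset.prod_insert hKs]
    congr 1
    rw [ih]
    · refine Finset.prod_congr rfl fun L hL => ?_
      congr 1
      ext e
      have : e ∈ L → e ∉ K := fun h => Finset.disjoint_left.1 (hne L hL) h
      simp only [Set.mem_inter_iff, Set.mem_sdiff, Finset.mem_coe]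
      tauto
    · exact (Finset.coe_subset.2 Finset.sdiff_subset).trans hE
    · exact fun L hL => Finset.subset_sdiff.2 ⟨hsE L (Finset.mem_insert_of_mem hL), hne L hL⟩
    · exact fun L hL => hs L (Finset.mem_insert_of_mem hL)
    · exact hdisj.subset (by simp)
    · rintro e ⟨he, heK⟩
      obtain ⟨L, hL, heL⟩ := hS e he
      rcases Finset.mem_insert.1 hL with rfl | hL
      · exact absurd heL heK
      · exact ⟨L, hL, heL⟩

/-! ### Spanning trees of induced subgraphs as maximal spanning forests -/

theorem mem_inducedEdges {W : Finset V} {e : Sym2 V} :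
    e ∈ inducedEdges G W ↔ (∀ v ∈ e, v ∈ W) ∧ e ∈ G.edgeSet := by
  classical
  rw [inducedEdges, Finset.mem_filter, Finset.mem_sym2_iff]

theorem reachable_induce_of_reachable {H : SimpleGraph V} {W : Set V}
    (hW : ∀ u v, H.Adj u v → v ∈ W) {u v : V} (h : H.Reachable u v) (hu : u ∈ W) :
    ∃ hv : v ∈ W, (H.induce W).Reachable ⟨u, hu⟩ ⟨v, hv⟩ := by
  obtain ⟨p⟩ := h
  induction p with
  | nil => exact ⟨hu, .rfl⟩
  | cons h p ih =>
    obtain ⟨hv, hr⟩ := ih (hW _ _ h)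
    exact ⟨hv, .trans (Adj.reachable (induce_adj.2 h)) hr⟩

theorem spanningTrees_eq {W : Finset V} (hW : (G.induce (W : Set V)).Connected) :
    spanningTrees G W = spanningForests (inducedEdges G W) := by
  classical
  ext T
  rw [spanningTrees, Finset.mem_filter, Finset.mem_powerset, mem_spanningForests,
    and_congr_right_iff]
  intro hT
  have hadj : ∀ u v, (fromEdgeSet (T : Set (Sym2 V))).Adj u v → v ∈ (W : Set V) := fun u v h =>
    (mem_inducedEdges.1 (hT ((fromEdgeSet_adj _).1 h).1)).1 v (by simp)
  constructor
  · intro h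
    constructor
    · intro v p hp
      have hsupp : ∀ x ∈ p.support, x ∈ (W : Set V) := by
        intro x hx
        cases p with
        | nil => simp at hp
        | cons h p =>
          rcases List.mem_cons.1 hx with rfl | hx
          · exact hadj _ _ h.symm
          · obtain ⟨q, r, -⟩ := Walk.mem_support_iff_exists_append.1 hx
            exact (reachable_induce_of_reachable hadj ⟨q⟩ (hadj _ _ h)).1
      refine h.isAcyclic (p.induce _ hsupp) (Walk.IsCycle.of_map (f := (Embedding.induce _).toHom) ?_)
      rwa [Walk.map_induce]
    · intro u v huv
      have := (mem_inducedEdges.1 huv).1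
      exact (h.connected.preconnected ⟨u, this u (by simp)⟩ ⟨v, this v (by simp)⟩).map
        (Embedding.induce _).toHom
  · rintro ⟨hac, hr⟩
    refine ⟨@Connected.mk _ _ ?_ hW.nonempty, hac.induce _⟩
    intro x y
    -- Each edge of a walk in the induced subgraph is replaced by a connection in `T`, which cannot
    -- leave `W`.
    obtain ⟨p⟩ := hW.preconnected x y
    induction p with
    | nil => exact .rfl
    | @cons x y z h p ih =>
      refine .trans ?_ ih
      have hmem : s(x.1, y.1) ∈ inducedEdges G W := mem_inducedEdges.2
        ⟨by simp, h⟩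
      exact (reachable_induce_of_reachable hadj (hr _ _ hmem) x.2).2

theorem ustProb_eq_forestProb (c : Sym2 V → ℝ) {W : Finset V}
    (hW : (G.induce (W : Set V)).Connected) (S : Set (Sym2 V)) :
    ustProb G c W S = forestProb c (inducedEdges G W) S := by
  rw [ustProb, forestProb, forestSum_empty, forestSum, spanningTrees_eq hW]

/-! ### Inclusion events and the forest law of a finite edge set -/

theorem measurableSet_setOf_subset {α : Type*} {S : Set α} (hS : S.Finite) :
    MeasurableSet {ω : Set α | S ⊆ ω} := by
  have : {ω : Set α | S ⊆ ω} = ⋂ e ∈ S, {ω | e ∈ ω} := by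
    ext ω
    simp [Set.subset_def]
  rw [this]
  exact .biInter hS.countable fun e _ => measurableSet_setOfPred.2 (measurable_set_mem e)

/-- Inclusion events form a π-system, as intersecting them takes the union of the sets `S`; those
with `S` a singleton already generate the product σ-algebra. -/
theorem ext_of_measure_setOf_subset {α : Type*} {μ ν : Measure (Set α)} [IsProbabilityMeasure μ]
    [IsProbabilityMeasure ν]
    (h : ∀ S : Finset α, μ {ω | (S : Set α) ⊆ ω} = ν {ω | (S : Set α) ⊆ ω}) : μ = ν := by
  classical
  refine ext_of_generate_finite (Set.range fun S : Finset α => {ω : Set α | (S : Set α) ⊆ ω})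
    ?_ ?_ ?_ (by simp)
  · apply le_antisymm
    · have : @Measurable _ _ (MeasurableSpace.generateFrom
          (Set.range fun S : Finset α => {ω : Set α | (S : Set α) ⊆ ω})) _ (id : Set α → Set α) := by
        refine @measurable_set_iff _ _ (_) _ |>.2 fun a => ?_
        refine (@measurableSet_setOfPred _ (_) _).1 ?_
        exact MeasurableSpace.measurableSet_generateFrom ⟨{a}, by simp⟩
      intro s hs
      exact this hs
    · refine MeasurableSpace.generateFrom_le ?_
      rintro _ ⟨S, rfl⟩
      exact measurableSet_setOf_subset S.finite_toSet
  · rintro _ ⟨S, rfl⟩ _ ⟨T, rfl⟩ -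
    exact ⟨S ∪ T, by ext ω; simp⟩
  · rintro _ ⟨S, rfl⟩
    exact h S

/-- The law of a random maximal spanning forest of `K`, with weights `treeWeight c`. -/
noncomputable def forestMeasure (G : SimpleGraph V) (c : Sym2 V → ℝ) (K : Finset (Sym2 V)) :
    Measure (Set G.edgeSet) :=
  ∑ A ∈ spanningForests K, ENNReal.ofReal (treeWeight c A / forestSum c K ∅) •
    Measure.dirac (Subtype.val ⁻¹' (A : Set (Sym2 V)))

theorem forestMeasure_setOf_subset {c : Sym2 V → ℝ} {K : Finset (Sym2 V)}
    (hc : ∀ e ∈ K, 0 < c e) {S : Set G.edgeSet} (hS : S.Finite) :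
    forestMeasure G c K {ω | S ⊆ ω} =
      ENNReal.ofReal (forestProb c K (Subtype.val '' S)) := by
  classical
  have hpos := forestSum_empty_pos hc
  rw [forestMeasure, Measure.coe_finsetSum, Finset.sum_apply, forestProb,
    forestSum.eq_1 c K (Subtype.val '' S), Finset.sum_div, ENNReal.ofReal_sum_of_nonneg, Finset.sum_filter]
  · refine Finset.sum_congr rfl fun A _ => ?_
    rw [Measure.smul_apply, Measure.dirac_apply' _ (measurableSet_setOf_subset hS),
      Set.image_subset_iff]
    by_cases h : S ⊆ Subtype.val ⁻¹' (A : Set (Sym2 V))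
    · rw [Set.indicator_of_mem (by exact h), if_pos h]
      simp
    · rw [Set.indicator_of_notMem (by exact h), if_neg h, smul_zero]
  · intro A hA
    exact div_nonneg (treeWeight_pos hc (Finset.mem_filter.1 hA).1).le hpos.le

theorem isProbabilityMeasure_forestMeasure {c : Sym2 V → ℝ} {K : Finset (Sym2 V)}
    (hc : ∀ e ∈ K, 0 < c e) : IsProbabilityMeasure (forestMeasure G c K) := by
  constructor
  have := forestMeasure_setOf_subset (G := G) hc Set.finite_empty
  simpa [forestProb_empty hc] using this

/-- Inside the edge set `K`, the configuration `ω` is a maximal spanning forest of `K`. -/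
def IsForestOn (K : Finset (Sym2 V)) (ω : Set G.edgeSet) : Prop :=
  ∃ A ∈ spanningForests K, ∀ e : G.edgeSet, e.1 ∈ K → (e ∈ ω ↔ e.1 ∈ A)

theorem measurableSet_isForestOn (K : Finset (Sym2 V)) :
    MeasurableSet {ω : Set G.edgeSet | IsForestOn K ω} := by
  have : {ω : Set G.edgeSet | IsForestOn K ω} = ⋃ A ∈ spanningForests K,
      ⋂ e ∈ {e : G.edgeSet | e.1 ∈ K}, {ω | e ∈ ω ↔ e.1 ∈ A} := by
    ext ω
    simp [IsForestOn]
  rw [this]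
  refine Finset.measurableSet_biUnion _ fun A _ => .biInter ?_ fun e _ => ?_
  · exact (K.finite_toSet.preimage Subtype.val_injective.injOn).countable
  · by_cases h : e.1 ∈ A
    · simpa [h] using measurableSet_setOfPred.2 (measurable_set_mem e)
    · simpa [h] using measurableSet_setOfPred.2 (measurable_set_notMem e)

theorem ae_isForestOn_forestMeasure (c : Sym2 V → ℝ) (K : Finset (Sym2 V)) :
    ∀ᵐ ω ∂forestMeasure G c K, IsForestOn K ω := by
  rw [ae_iff, forestMeasure, Measure.coe_finsetSum, Finset.sum_apply]
  refine Finset.sum_eq_zero fun A hA => ?_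
  have hmeas : MeasurableSet {ω : Set G.edgeSet | ¬IsForestOn K ω} :=
    (measurableSet_isForestOn K).compl
  rw [Measure.smul_apply, Measure.dirac_apply' _ hmeas, Set.indicator_of_notMem, smul_zero]
  exact fun h => h ⟨A, hA, fun e _ => Iff.rfl⟩

/-! ### Independent forests on the blocks -/

section Product

variable (hfin : ∀ e : G.edgeSet, {f | PathMate G e f}.Finite)

/-- The block of an edge. -/
noncomputable def edgeBlock (e : G.edgeSet) :
    {K : Finset (Sym2 V) // (K : Set (Sym2 V)) ⊆ G.edgeSet} :=
  ⟨(hfin e).toFinset, by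
    rw [Set.Finite.coe_toFinset]
    exact fun _ hf => hf.mem_edgeSet⟩

theorem mem_edgeBlock {e : G.edgeSet} {f : Sym2 V} :
    f ∈ (edgeBlock hfin e).1 ↔ PathMate G e f := by
  simp [edgeBlock]

theorem mem_edgeBlock_self (e : G.edgeSet) : e.1 ∈ (edgeBlock hfin e).1 :=
  (mem_edgeBlock hfin).2 (.refl e.2)

theorem cycleClosed_edgeBlock (e : G.edgeSet) :
    CycleClosed G ((edgeBlock hfin e).1 : Set (Sym2 V)) := by
  simpa [edgeBlock] using cycleClosed_setOf_pathMate e.1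

/-- Blocks are equivalence classes, so they partition the edges. -/
theorem mem_edgeBlock_iff {e f : G.edgeSet} :
    f.1 ∈ (edgeBlock hfin e).1 ↔ edgeBlock hfin f = edgeBlock hfin e := by
  refine ⟨fun h => ?_, fun h => h ▸ mem_edgeBlock_self hfin f⟩
  rw [mem_edgeBlock] at h
  ext g
  rw [mem_edgeBlock, mem_edgeBlock]
  exact ⟨h.trans, (h.symm e.2).trans⟩

/-- The random set of edges whose restrictions to the blocks are prescribed by `ω`. -/
def glue (ω : {K : Finset (Sym2 V) // (K : Set (Sym2 V)) ⊆ G.edgeSet} → Set G.edgeSet) :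
    Set G.edgeSet :=
  {e | e ∈ ω (edgeBlock hfin e)}

/-- The index type consists of all finite edge sets, but `glue` reads only the coordinates that are
blocks. Membership of an edge depends on a single coordinate. -/
theorem measurable_glue : Measurable (glue hfin) :=
  measurable_set_iff.2 fun e => by
    have := (measurable_set_mem e).comp
      (measurable_pi_apply (X := fun _ => Set G.edgeSet) (edgeBlock hfin e))
    exact this

variable {c : Sym2 V → ℝ}

/-- The law of the union of independent random spanning trees of the blocks of `G`. -/
noncomputable def blockForestMeasure (c : Sym2 V → ℝ) : Measure (Set G.edgeSet) :=
  (Measure.infinitePi fun K : {K : Finset (Sym2 V) // (K : Set (Sym2 V)) ⊆ G.edgeSet} =>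
    forestMeasure G c K.1).map (glue hfin)

theorem isProbabilityMeasure_blockForestMeasure (hc : ∀ e ∈ G.edgeSet, 0 < c e) :
    IsProbabilityMeasure (blockForestMeasure hfin c) := by
  have (K : {K : Finset (Sym2 V) // (K : Set (Sym2 V)) ⊆ G.edgeSet}) :
      IsProbabilityMeasure (forestMeasure G c K.1) :=
    isProbabilityMeasure_forestMeasure fun e he => hc e (K.2 he)
  exact Measure.isProbabilityMeasure_map (measurable_glue hfin).aemeasurable

theorem ae_isForestOn_blockForestMeasure (hc : ∀ e ∈ G.edgeSet, 0 < c e) (e : G.edgeSet) :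
    ∀ᵐ ω ∂blockForestMeasure hfin c, IsForestOn (edgeBlock hfin e).1 ω := by
  have (K : {K : Finset (Sym2 V) // (K : Set (Sym2 V)) ⊆ G.edgeSet}) :
      IsProbabilityMeasure (forestMeasure G c K.1) :=
    isProbabilityMeasure_forestMeasure fun e he => hc e (K.2 he)
  rw [blockForestMeasure, ae_map_iff (measurable_glue hfin).aemeasurable
    (measurableSet_isForestOn _)]
  have := (measurePreserving_eval_infinitePi
    (fun K : {K : Finset (Sym2 V) // (K : Set (Sym2 V)) ⊆ G.edgeSet} => forestMeasure G c K.1)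
    (edgeBlock hfin e)).quasiMeasurePreserving.ae (ae_isForestOn_forestMeasure c _)
  filter_upwards [this] with ω ⟨A, hA, h⟩
  refine ⟨A, hA, fun f hf => ?_⟩
  rw [← h f hf, ← (mem_edgeBlock_iff hfin).1 hf]
  rfl

-- Independence turns the left side into a product over the blocks meeting `S`, which the
-- factorization identifies with the probability in any `E` containing them.
open scoped Classical in
theorem blockForestMeasure_setOf_subset (hc : ∀ e ∈ G.edgeSet, 0 < c e)
    (S : Finset G.edgeSet) {E : Finset (Sym2 V)}
    (hE : (E : Set (Sym2 V)) ⊆ G.edgeSet) (hSE : ∀ e ∈ S, (edgeBlock hfin e).1 ⊆ E) :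
    blockForestMeasure hfin c {ω | (S : Set G.edgeSet) ⊆ ω} =
      ENNReal.ofReal (forestProb c E (Subtype.val '' (S : Set G.edgeSet))) := by
  have (K : {K : Finset (Sym2 V) // (K : Set (Sym2 V)) ⊆ G.edgeSet}) :
      IsProbabilityMeasure (forestMeasure G c K.1) :=
    isProbabilityMeasure_forestMeasure fun e he => hc e (K.2 he)
  -- Sorting the edges of `S` by block makes the event a cylinder in finitely many coordinates.
  have hpre : glue hfin ⁻¹' {ω | (S : Set G.edgeSet) ⊆ ω} =
      Set.pi (S.image (edgeBlock hfin) : Finset _)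
        fun K => {ω | {e | e ∈ S ∧ edgeBlock hfin e = K} ⊆ ω} := by
    ext ω
    constructor
    · rintro h K - e ⟨he, rfl⟩
      exact h he
    · intro h e he
      exact h _ (Finset.mem_coe.2 (Finset.mem_image_of_mem _ he)) ⟨he, rfl⟩
  have hfinS : ∀ K, {e | e ∈ S ∧ edgeBlock hfin e = K}.Finite := fun K =>
    S.finite_toSet.subset fun e he => he.1
  rw [blockForestMeasure, Measure.map_apply (measurable_glue hfin)
    (measurableSet_setOf_subset S.finite_toSet), hpre,
    Measure.infinitePi_pi _ fun K _ => measurableSet_setOf_subset (hfinS K),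
    forestProb_eq_prod hc ((S.image (edgeBlock hfin)).map (.subtype _)) hE]
  · rw [Finset.prod_map, ENNReal.ofReal_prod_of_nonneg]
    · refine Finset.prod_congr rfl fun K hK => ?_
      rw [forestMeasure_setOf_subset (fun e he => hc e (K.2 he)) (hfinS K)]
      congr 2
      obtain ⟨e₀, -, rfl⟩ := Finset.mem_image.1 hK
      ext e
      constructor
      · rintro ⟨f, ⟨hf, hfK⟩, rfl⟩
        exact ⟨⟨f, hf, rfl⟩, (mem_edgeBlock_iff hfin).2 hfK⟩
      · rintro ⟨⟨f, hf, rfl⟩, hfK⟩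
        exact ⟨f, ⟨hf, (mem_edgeBlock_iff hfin).1 hfK⟩, rfl⟩
    · intro K _
      have hcK : ∀ e ∈ K.1, 0 < c e := fun e he => hc e (K.2 he)
      exact div_nonneg (Finset.sum_nonneg fun A hA =>
        (treeWeight_pos hcK (Finset.mem_filter.1 hA).1).le) (forestSum_empty_pos hcK).le
  · simp only [Finset.mem_map, Finset.mem_image]
    rintro _ ⟨_, ⟨e, he, rfl⟩, rfl⟩
    exact hSE e he
  · simp only [Finset.mem_map, Finset.mem_image]
    rintro _ ⟨_, ⟨e, -, rfl⟩, rfl⟩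
    exact cycleClosed_edgeBlock hfin e
  · simp only [Set.PairwiseDisjoint, Set.Pairwise, Finset.mem_coe, Finset.mem_map,
      Finset.mem_image]
    rintro _ ⟨_, ⟨e, -, rfl⟩, rfl⟩ _ ⟨_, ⟨f, -, rfl⟩, rfl⟩ hne
    refine Finset.disjoint_left.2 fun g hge hgf => hne ?_
    have hg : g ∈ G.edgeSet := (edgeBlock hfin e).2 hge
    congr 1
    exact ((mem_edgeBlock_iff hfin (f := ⟨g, hg⟩)).1 hge).symm.trans
      ((mem_edgeBlock_iff hfin (f := ⟨g, hg⟩)).1 hgf)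
  · rintro _ ⟨e, he, rfl⟩
    exact ⟨_, Finset.mem_map_of_mem _ (Finset.mem_image_of_mem _ he), mem_edgeBlock_self hfin e⟩

/-! ### Convergence along exhaustions and the tree property -/

theorem IsExhaustion.eventually_subset_inducedEdges {W : ℕ → Finset V} (hW : IsExhaustion G W)
    {E : Finset (Sym2 V)} (hE : (E : Set (Sym2 V)) ⊆ G.edgeSet) :
    ∀ᶠ n in atTop, E ⊆ inducedEdges G (W n) := by
  have hmem : ∀ v, ∀ᶠ n in atTop, v ∈ W n := fun v => by
    obtain ⟨m, hm⟩ := hW.exhausts v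
    filter_upwards [eventually_ge_atTop m] with n hn
    exact monotone_nat_of_le_succ hW.subset_succ hn hm
  refine (E.eventually_all.2 fun e he => ?_ : ∀ᶠ n in atTop, ∀ e ∈ E, e ∈ inducedEdges G (W n))
  have heG := hE he
  induction e with
  | h a b =>
    filter_upwards [hmem a, hmem b] with n ha hb
    exact mem_inducedEdges.2 ⟨by simp [ha, hb], heG⟩

theorem isFSF_blockForestMeasure (hc : ∀ e ∈ G.edgeSet, 0 < c e) :
    IsFSF G c (blockForestMeasure hfin c) where
  isProbabilityMeasure := isProbabilityMeasure_blockForestMeasure hfin hc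
  tendsto_ustProb W hW S := by
    classical
    -- The sequence is eventually constant: it equals the limit once all blocks meeting `S` are
    -- inside `W n`.
    refine tendsto_const_nhds.congr' ?_
    have hsub : ((S.biUnion fun e => (edgeBlock hfin e).1 : Finset (Sym2 V)) : Set (Sym2 V)) ⊆
        G.edgeSet := by
      rw [Finset.coe_biUnion]
      exact Set.iUnion₂_subset fun e _ => (edgeBlock hfin e).2
    filter_upwards [hW.eventually_subset_inducedEdges hsub] with n hn
    have hE : (inducedEdges G (W n) : Set (Sym2 V)) ⊆ G.edgeSet := fun e he =>
      (mem_inducedEdges.1 he).2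
    have hcE : ∀ e ∈ inducedEdges G (W n), 0 < c e := fun e he => hc e (hE he)
    rw [ustProb_eq_forestProb c (hW.connected n), measureReal_def,
      blockForestMeasure_setOf_subset hfin hc S hE fun e he =>
        (Finset.subset_biUnion_of_mem (fun e => (edgeBlock hfin e).1) he).trans hn,
      ENNReal.toReal_ofReal]
    exact div_nonneg (Finset.sum_nonneg fun A hA =>
      (treeWeight_pos hcE (Finset.mem_filter.1 hA).1).le) (forestSum_empty_pos hcE).le

theorem isTree_forestGraph (hG : G.Connected) {ω : Set G.edgeSet}
    (hω : ∀ e, IsForestOn (edgeBlock hfin e).1 ω) : (forestGraph G ω).IsTree := by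
  have hsub : Subtype.val '' ω ⊆ G.edgeSet := by
    rintro _ ⟨e, -, rfl⟩
    exact e.2
  have := hG.nonempty
  refine ⟨⟨fun u v => ?_⟩, ?_⟩
  · obtain ⟨p⟩ := hG.preconnected u v
    induction p with
    | nil => exact .rfl
    | @cons u w v h p ih =>
      refine .trans ?_ ih
      obtain ⟨A, hA, hAω⟩ := hω ⟨s(u, w), h⟩
      obtain ⟨hAK, -, hr⟩ := mem_spanningForests.1 hA
      refine (hr u w (mem_edgeBlock_self hfin ⟨s(u, w), h⟩)).mono (fromEdgeSet_mono fun f hf => ?_)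
      have hfG := (edgeBlock hfin _).2 (hAK hf)
      exact ⟨⟨f, hfG⟩, (hAω ⟨f, hfG⟩ (hAK hf)).2 hf, rfl⟩
  · rw [forestGraph, isAcyclic_fromEdgeSet_iff hsub]
    intro v p hp hpω
    obtain ⟨e, he⟩ : ∃ e, e ∈ p.edges :=
      List.exists_mem_of_ne_nil _ fun h => hp.not_nil (Walk.edges_eq_nil.1 h)
    have heG := p.edges_subset_edgeSet he
    obtain ⟨A, hA, hAω⟩ := hω ⟨e, heG⟩
    obtain ⟨hAK, hac, -⟩ := mem_spanningForests.1 hA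
    rw [isAcyclic_fromEdgeSet_iff
      ((Finset.coe_subset.2 hAK).trans (edgeBlock hfin ⟨e, heG⟩).2)] at hac
    refine hac v p hp fun f hf => ?_
    obtain ⟨f, hfω, rfl⟩ := hpω f hf
    exact (hAω f (cycleClosed_edgeBlock hfin ⟨e, heG⟩ v p hp e he f hf
      (mem_edgeBlock_self hfin ⟨e, heG⟩))).1 hfω

end Product

/-! ### Uniqueness and the main theorem -/

theorem IsFSF.eq {c : Sym2 V → ℝ} {W : ℕ → Finset V} (hW : IsExhaustion G W)
    {μ ν : Measure (Set G.edgeSet)} (hμ : IsFSF G c μ) (hν : IsFSF G c ν) : μ = ν := by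
  have := hμ.isProbabilityMeasure
  have := hν.isProbabilityMeasure
  exact ext_of_measure_setOf_subset fun S => (measureReal_eq_measureReal_iff).1
    (tendsto_nhds_unique (hμ.tendsto_ustProb W hW S) (hν.tendsto_ustProb W hW S))

theorem IsExhaustion.countable {W : ℕ → Finset V} (hW : IsExhaustion G W) : Countable V := by
  rw [← Set.countable_univ_iff]
  exact (Set.countable_iUnion fun n => (W n).countable_toSet).mono fun v _ =>
    Set.mem_iUnion.2 (hW.exhausts v)

end FreeForest

theorem theorem4p3 {V : Type*} [Infinite V] (G : SimpleGraph V) [G.LocallyFinite]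
    (hG : G.Connected)
    (hcyc : ∃ ℓ : ℕ, ∀ (v : V) (p : G.Walk v v), p.IsCycle → p.length ≤ ℓ)
    (c : Sym2 V → ℝ) (hc : ∀ e ∈ G.edgeSet, 0 < c e) :
    (∃! μ : Measure (Set G.edgeSet), FreeForest.IsFSF G c μ) ∧
      ∀ μ : Measure (Set G.edgeSet), FreeForest.IsFSF G c μ →
        ∀ᵐ ω ∂μ, (FreeForest.forestGraph G ω).IsTree := by
  obtain ⟨ℓ, hℓ⟩ := hcyc
  have hfin (e : G.edgeSet) := FreeForest.finite_setOf_pathMate hℓ e.2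
  have hW := FreeForest.isExhaustion_finBall hG (Classical.arbitrary V)
  have hfsf := FreeForest.isFSF_blockForestMeasure hfin hc
  refine ⟨⟨_, hfsf, fun μ hμ => hμ.eq hW hfsf⟩, fun μ hμ => ?_⟩
  obtain rfl := hμ.eq hW hfsf
  -- Countably many edges allow the almost sure statements for single blocks to hold simultaneously.
  have := hW.countable
  have : Countable (Sym2 V) := Quotient.countable
  filter_upwards [ae_all_iff.2 (FreeForest.ae_isForestOn_blockForestMeasure hfin hc)] with ω hω
  exact FreeForest.isTree_forestGraph hfin hG hω
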